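/- Let $K$ be a compact metric space. Put $K^{(0)}=K$, let $K^{(\alpha+1)}$ be the set of limit points of $K^{(\alpha)}$, and $K^{(\alpha)}=\bigcap_{\alpha'<\alpha}K^{(\alpha')}$ for limit ordinals $\alpha$. A function $f:K\to\mathbb{R}$ is Baire-1 if it is the pointwise limit of a sequence of continuous real-valued functions on $K$; let $\mathfrak{B}_1(K)$ be the set of all (not necessarily bounded) Baire-1 functions on $K$. For $f:K\to\mathbb{R}$ and $\varepsilon>0$ let $K^{0}(f,\varepsilon)=K$; let $K^{\alpha+1}(f,\varepsilon)$ be the set of all $x\in K^{\alpha}(f,\varepsilon)$ such that every open set $U$ containing $x$ contains two points $x_1,x_2\in U\cap K^{\alpha}(f,\varepsilon)$ with $|f(x_1)-f(x_2)|\ge\varepsilon$; and let $K^{\alpha}(f,\varepsilon)=\bigcap_{\alpha'<\alpha}K^{\alpha'}(f,\varepsilon)$ for limit $\alpha$. Let $\beta(f,\varepsilon)$ be the least countable ordinal $\alpha$ with $K^{\alpha}(f,\varepsilon)=\emptyset$ if there is one, and $\omega_1$ otherwise, and let $\beta(f)=\sup_{\varepsilon>0}\beta(f,\varepsilon)$.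 For a countable ordinal $\xi$ let $\mathfrak{B}_1^{\xi}(K)=\{f\in\mathfrak{B}_1(K):\beta(f)\le\omega^{\xi}\}$. **Theorem.** Suppose that $\xi_1,\xi_2$ are countable ordinals, and let $\xi=\max\{\xi_1+\xi_2,\ \xi_2+\xi_1\}$. If $K$ is a compact metric space such that $K^{(\omega^{\xi})}\neq\emptyset$, then $$\sup\{\beta(fg): f\in\mathfrak{B}_1^{\xi_1}(K),\ g\in\mathfrak{B}_1^{\xi_2}(K)\}=\omega^{\xi}.$$ -/

import Mathlib

open Ordinal Filter Topology

universe u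

/-- One step of the oscillation derivation: the points of `P` such that in every open
neighbourhood `f` takes at two points of `P` values that differ by at least `ε`. -/
def oscStep {K : Type u} [TopologicalSpace K] (f : K → ℝ) (ε : ℝ) (P : Set K) : Set K :=
  {x | x ∈ P ∧ ∀ U : Set K, IsOpen U → x ∈ U →
    ∃ x₁ ∈ U ∩ P, ∃ x₂ ∈ U ∩ P, ε ≤ |f x₁ - f x₂|}

/-- The oscillation derived sets `K^α(f, ε)`, by transfinite recursion (see `oscDeriv_zero`,
`oscDeriv_succ` and `oscDeriv_limit`). -/
noncomputable def oscDeriv {K : Type u} [TopologicalSpace K] (f : K → ℝ) (ε : ℝ)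
    (α : Ordinal.{u}) : Set K :=
  Ordinal.limitRecOn (motive := fun _ => Set K) α Set.univ (fun _ P => oscStep f ε P)
    (fun γ _ P => ⋂ (δ : Ordinal.{u}) (h : δ < γ), P δ h)

theorem oscDeriv_zero {K : Type u} [TopologicalSpace K] (f : K → ℝ) (ε : ℝ) :
    oscDeriv f ε 0 = Set.univ :=
  Ordinal.limitRecOn_zero ..

theorem oscDeriv_succ {K : Type u} [TopologicalSpace K] (f : K → ℝ) (ε : ℝ) (α : Ordinal.{u}) :
    oscDeriv f ε (α + 1) = oscStep f ε (oscDeriv f ε α) :=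
  Ordinal.limitRecOn_add_one ..

theorem oscDeriv_limit {K : Type u} [TopologicalSpace K] (f : K → ℝ) (ε : ℝ) {α : Ordinal.{u}}
    (hα : Order.IsSuccLimit α) :
    oscDeriv f ε α = ⋂ (δ : Ordinal.{u}) (_ : δ < α), oscDeriv f ε δ :=
  Ordinal.limitRecOn_limit _ _ _ _ hα

open Classical in
/-- `β(f, ε)`: the least `α` with `K^α(f, ε) = ∅` if there is a countable such `α`, and `ω₁`
otherwise. -/
noncomputable def oscIndexAt {K : Type u} [TopologicalSpace K] (f : K → ℝ) (ε : ℝ) :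
    Ordinal.{u} :=
  if ∃ α : Ordinal.{u}, α < ω_ 1 ∧ oscDeriv f ε α = ∅ then
    sInf {α : Ordinal.{u} | oscDeriv f ε α = ∅}
  else ω_ 1

theorem oscIndexAt_le {K : Type u} [TopologicalSpace K] (f : K → ℝ) (ε : ℝ) :
    oscIndexAt f ε ≤ ω_ 1 := by
  unfold oscIndexAt
  split_ifs with h
  · obtain ⟨α, hα, h0⟩ := h
    have h1 : sInf {α : Ordinal.{u} | oscDeriv f ε α = ∅} ≤ α := csInf_le' h0
    exact h1.trans hα.le
  · exact le_rfl

/-- The oscillation index `β(f) = sup {β(f, ε) : ε > 0}`; the supremum is over a family bounded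
by `ω₁` (see `isLUB_oscIndex`). -/
noncomputable def oscIndex {K : Type u} [TopologicalSpace K] (f : K → ℝ) : Ordinal.{u} :=
  ⨆ ε : {ε : ℝ // 0 < ε}, oscIndexAt f ε.1

theorem isLUB_oscIndex {K : Type u} [TopologicalSpace K] (f : K → ℝ) :
    IsLUB {b : Ordinal.{u} | ∃ ε : ℝ, 0 < ε ∧ b = oscIndexAt f ε} (oscIndex f) := by
  have hbdd : BddAbove (Set.range fun ε : {ε : ℝ // 0 < ε} => oscIndexAt f ε.1) :=
    ⟨ω_ 1, by rintro _ ⟨ε, rfl⟩; exact oscIndexAt_le f ε.1⟩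
  constructor
  · rintro _ ⟨ε, hε, rfl⟩
    exact le_ciSup hbdd ⟨ε, hε⟩
  · intro c hc
    exact ciSup_le' fun ε => hc ⟨ε.1, ε.2, rfl⟩

/-- Real-valued functions of Baire class one: pointwise limits of sequences of continuous
real-valued functions. -/
def IsBaireOne {K : Type u} [TopologicalSpace K] (f : K → ℝ) : Prop :=
  ∃ F : ℕ → K → ℝ, (∀ n, Continuous (F n)) ∧
    ∀ x, Tendsto (fun n => F n x) atTop (𝓝 (f x))

/-- The (not necessarily bounded) functions of small Baire class `ξ` on `K`. -/
def smallBaireClass (K : Type u) [TopologicalSpace K] (ξ : Ordinal.{u}) : Set (K → ℝ) :=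
  {f | IsBaireOne f ∧ oscIndex f ≤ ω ^ ξ}

/-! Upper bound. Write `fg(y) - fg(z) = f(y)(g(y) - g(z)) + g(z)(f(y) - f(z))`. Near a point, `f` is
bounded on the level of its own derivation at scale `1`; there the first term is small once `g` is
resolved at a scale adapted to that bound. Ranking lexicographically, the level of `f` first and
that of `g` second, gives a rank below `ω ^ (ξ₂ + ξ₁)` (`exists_productRank`). The second term gives
one below `ω ^ (ξ₁ + ξ₂)`. The natural sum of the two ranks controls both terms, and powers of `ω`
are closed under it (`oscIndex_mul_le`).

Lower bound. For each `γ < ω ^ ξ` there is a countable closed scattered set with top rank `1 + γ`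
(`exists_isScatteredRank`), and the parity of its rank function survives `γ` derivations
(`le_oscDeriv_parity`). This parity is factored as `(parity / N) * N`, where `N` is continuous on
each block of ranks with the same quotient by a power of `ω` and blows up as lower blocks approach a
higher one. The quotient sees only ranks inside a block, while `N` sees only the block
(`exists_factorization`). -/

/-! ### Natural sums and powers of `ω` -/

/-- The natural (Hessenberg) sum of two ordinals. -/
noncomputable def natSum (a b : Ordinal.{u}) : Ordinal.{u} :=
  max (⨆ x : Set.Iio a, Order.succ (natSum x.1 b)) (⨆ x : Set.Iio b, Order.succ (natSum a x.1))
termination_by (a, b)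
decreasing_by
  · exact Prod.Lex.left _ _ x.2
  · exact Prod.Lex.right _ x.2

theorem natSum_le_iff {a b c : Ordinal.{u}} :
    natSum a b ≤ c ↔ (∀ x < a, natSum x b < c) ∧ ∀ x < b, natSum a x < c := by
  rw [natSum, max_le_iff, Ordinal.iSup_le_iff, Ordinal.iSup_le_iff]
  simp

theorem natSum_lt_left {a a' : Ordinal.{u}} (h : a' < a) (b : Ordinal.{u}) :
    natSum a' b < natSum a b :=
  (natSum_le_iff.1 le_rfl).1 a' h

theorem natSum_lt_right {b b' : Ordinal.{u}} (a : Ordinal.{u}) (h : b' < b) :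
    natSum a b' < natSum a b :=
  (natSum_le_iff.1 le_rfl).2 b' h

theorem natSum_mono {a a' b b' : Ordinal.{u}} (ha : a' ≤ a) (hb : b' ≤ b) :
    natSum a' b' ≤ natSum a b := by
  have h1 : natSum a' b' ≤ natSum a b' := by
    rcases ha.lt_or_eq with h | rfl
    · exact (natSum_lt_left h b').le
    · exact le_rfl
  have h2 : natSum a b' ≤ natSum a b := by
    rcases hb.lt_or_eq with h | rfl
    · exact (natSum_lt_right a h).le
    · exact le_rfl
  exact h1.trans h2

/-- Strict monotonicity in both arguments leaves no slack. Ordinary addition is not strictly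
monotone on the left, which is why the natural sum is used to combine ranks. -/
theorem eq_of_natSum_le {a a' b b' : Ordinal.{u}} (ha : a' ≤ a) (hb : b' ≤ b)
    (h : natSum a b ≤ natSum a' b') : a' = a ∧ b' = b := by
  refine ⟨ha.eq_of_not_lt fun hlt => ?_, hb.eq_of_not_lt fun hlt => ?_⟩
  · exact (((natSum_lt_left hlt b').trans_le (natSum_mono le_rfl hb)).trans_le h).false
  · exact (((natSum_lt_right a' hlt).trans_le (natSum_mono ha le_rfl)).trans_le h).false

theorem mul_natCast_add_lt {p r s : Ordinal.{u}} {m n : ℕ} (hr : r < p) (hmn : m < n) :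
    p * m + r < p * n + s := by
  calc p * m + r < p * m + p := by gcongr
    _ = p * ((m + 1 : ℕ) : Ordinal) := by push_cast; rw [mul_add_one]
    _ ≤ p * n := by gcongr; exact_mod_cast hmn
    _ ≤ p * n + s := le_self_add

theorem exists_eq_mul_natCast_add {p a : Ordinal.{u}} (hp : p ≠ 0) {i : ℕ} {r : Ordinal.{u}}
    (ha : a < p * i + r) (hr : r < p) : ∃ i' : ℕ, ∃ r' < p, a = p * i' + r' ∧
      (i' < i ∨ i' = i ∧ r' < r) := by
  have hlt : a / p < Order.succ (i : Ordinal) := by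
    rw [← Ordinal.lt_mul_iff_div_lt hp]
    rw [Order.succ_eq_add_one, mul_add_one]
    exact ha.trans (by gcongr)
  obtain ⟨n, hn⟩ := lt_omega0.1 ((Order.lt_succ_iff.1 hlt).trans_lt (natCast_lt_omega0 i))
  have hdecomp : a = p * n + a % p := by rw [← hn, div_add_mod]
  have hni : n ≤ i := by
    have := Order.lt_succ_iff.1 hlt
    rw [hn] at this
    exact_mod_cast this
  refine ⟨n, a % p, mod_lt _ hp, hdecomp, ?_⟩
  rcases hni.lt_or_eq with h | rfl
  · exact Or.inl h
  · rw [hdecomp] at ha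
    exact Or.inr ⟨rfl, lt_of_add_lt_add_left ha⟩

/-- Leading coefficients add as natural numbers, since the sum of two remainders stays below `p` and
never carries. Lowering one argument lowers either its coefficient or its remainder. -/
theorem natSum_mul_natCast_add_le {p : Ordinal.{u}} (hp : p ≠ 0)
    (hcl : ∀ a < p, ∀ b < p, natSum a b < p) (a b : Ordinal.{u}) :
    ∀ (i j : ℕ) (r s : Ordinal.{u}), r < p → s < p → a = p * i + r → b = p * j + s →
      natSum a b ≤ p * ((i + j : ℕ) : Ordinal) + natSum r s := by
  induction a using WellFoundedLT.induction generalizing b with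
  | ind a iha =>
  induction b using WellFoundedLT.induction with
  | ind b ihb =>
  rintro i j r s hr hs rfl rfl
  rw [natSum_le_iff]
  constructor
  · intro x hx
    obtain ⟨i', r', hr', rfl, h⟩ := exists_eq_mul_natCast_add hp hx hr
    refine (iha _ hx _ i' j r' s hr' hs rfl rfl).trans_lt ?_
    rcases h with h | ⟨rfl, h⟩
    · exact mul_natCast_add_lt (hcl _ hr' _ hs) (by omega)
    · gcongr
      exact natSum_lt_left h s
  · intro x hx
    obtain ⟨j', s', hs', rfl, h⟩ := exists_eq_mul_natCast_add hp hx hs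
    refine (ihb _ hx i j' r s' hr hs' rfl rfl).trans_lt ?_
    rcases h with h | ⟨rfl, h⟩
    · exact mul_natCast_add_lt (hcl _ hr _ hs') (by omega)
    · gcongr
      exact natSum_lt_right r h

theorem natSum_lt_omega0_opow (ξ : Ordinal.{u}) :
    ∀ a < ω ^ ξ, ∀ b < ω ^ ξ, natSum a b < ω ^ ξ := by
  induction ξ using Ordinal.limitRecOn with
  | zero =>
    intro a ha b hb
    rw [opow_zero, Order.lt_one_iff] at *
    subst ha hb
    rw [← le_zero_iff, natSum_le_iff]
    simp
  | add_one γ ih =>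
    have hp : (ω : Ordinal.{u}) ^ γ ≠ 0 := opow_ne_zero _ omega0_ne_zero
    have key : ∀ a < (ω : Ordinal.{u}) ^ (γ + 1), ∃ i : ℕ, ∃ r < ω ^ γ, a = ω ^ γ * i + r := by
      intro a ha
      rw [opow_add_one, lt_mul_iff_of_isSuccLimit isSuccLimit_omega0] at ha
      obtain ⟨c, hc, hac⟩ := ha
      obtain ⟨n, rfl⟩ := lt_omega0.1 hc
      obtain ⟨i, r, hr, h, -⟩ := exists_eq_mul_natCast_add (r := 0) hp (by simpa using hac)
        (pos_iff_ne_zero.2 hp)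
      exact ⟨i, r, hr, h⟩
    intro a ha b hb
    obtain ⟨i, r, hr, rfl⟩ := key a ha
    obtain ⟨j, s, hs, rfl⟩ := key b hb
    refine (natSum_mul_natCast_add_le hp ih _ _ i j r s hr hs rfl rfl).trans_lt ?_
    have := mul_natCast_add_lt (s := 0) (ih _ hr _ hs) (Nat.lt_succ_self (i + j))
    refine this.trans ?_
    rw [add_zero, opow_add_one]
    exact mul_lt_mul_of_pos_left (natCast_lt_omega0 _) (pos_iff_ne_zero.2 hp)
  | limit γ hγ ih =>
    intro a ha b hb
    rw [lt_opow_of_isSuccLimit omega0_ne_zero hγ] at ha hb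
    obtain ⟨c, hc, hac⟩ := ha
    obtain ⟨d, hd, hbd⟩ := hb
    have hm : max c d < γ := max_lt hc hd
    refine (ih _ hm a (hac.trans_le ?_) b (hbd.trans_le ?_)).trans_le ?_
    · exact opow_le_opow_right omega0_pos (le_max_left _ _)
    · exact opow_le_opow_right omega0_pos (le_max_right _ _)
    · exact opow_le_opow_right omega0_pos hm.le

theorem omega0_opow_lt_omega_one {ξ : Ordinal.{u}} (h : ξ < ω_ 1) : ω ^ ξ < ω_ 1 :=
  isPrincipal_opow_omega 1 (omega0_lt_omega_one) h

/-! ### Derived sets and rank functions -/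

section Oscillation

variable {K : Type u} [TopologicalSpace K]

theorem mem_oscStep_iff {f : K → ℝ} {ε : ℝ} {P : Set K} {x : K} :
    x ∈ oscStep f ε P ↔ x ∈ P ∧ ∀ U ∈ 𝓝 x, ∃ y ∈ U, ∃ z ∈ U, y ∈ P ∧ z ∈ P ∧ ε ≤ |f y - f z| := by
  refine and_congr_right fun _ => ⟨fun h U hU => ?_, fun h U hU hx => ?_⟩
  · obtain ⟨V, hVU, hV, hxV⟩ := mem_nhds_iff.1 hU
    obtain ⟨y, hy, z, hz, hyz⟩ := h V hV hxV
    exact ⟨y, hVU hy.1, z, hVU hz.1, hy.2, hz.2, hyz⟩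
  · obtain ⟨y, hy, z, hz, hyP, hzP, hyz⟩ := h U (hU.mem_nhds hx)
    exact ⟨y, ⟨hy, hyP⟩, z, ⟨hz, hzP⟩, hyz⟩

theorem oscStep_subset (f : K → ℝ) (ε : ℝ) (P : Set K) : oscStep f ε P ⊆ P := fun _ h => h.1

theorem oscStep_mono (f : K → ℝ) {ε δ : ℝ} (h : δ ≤ ε) {P Q : Set K} (hPQ : P ⊆ Q) :
    oscStep f ε P ⊆ oscStep f δ Q := by
  intro x hx
  rw [mem_oscStep_iff] at hx ⊢
  refine ⟨hPQ hx.1, fun U hU => ?_⟩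
  obtain ⟨y, hy, z, hz, hyP, hzP, hyz⟩ := hx.2 U hU
  exact ⟨y, hy, z, hz, hPQ hyP, hPQ hzP, h.trans hyz⟩

theorem isClosed_oscStep (f : K → ℝ) (ε : ℝ) {P : Set K} (hP : IsClosed P) :
    IsClosed (oscStep f ε P) := by
  have : oscStep f ε P = P ∩ {x | ∀ U : Set K, IsOpen U → x ∈ U →
      ∃ x₁ ∈ U ∩ P, ∃ x₂ ∈ U ∩ P, ε ≤ |f x₁ - f x₂|} := rfl
  rw [this]
  refine hP.inter (isOpen_compl_iff.1 (isOpen_iff_forall_mem_open.2 fun x hx => ?_))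
  simp only [Set.mem_compl_iff, Set.mem_ofPred_eq, not_forall] at hx
  obtain ⟨U, hU, hxU, hne⟩ := hx
  exact ⟨U, fun y hy h => hne (h U hU hy), hU, hxU⟩

theorem isClosed_oscDeriv (f : K → ℝ) (ε : ℝ) (α : Ordinal.{u}) : IsClosed (oscDeriv f ε α) := by
  induction α using Ordinal.limitRecOn with
  | zero => rw [oscDeriv_zero]; exact isClosed_univ
  | add_one α ih => rw [oscDeriv_succ]; exact isClosed_oscStep f ε ih
  | limit α hα ih =>
    rw [oscDeriv_limit f ε hα]
    exact isClosed_iInter fun δ => isClosed_iInter fun hδ => ih δ hδ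

theorem oscDeriv_antitone (f : K → ℝ) (ε : ℝ) : Antitone (oscDeriv f ε) := by
  intro α β h
  induction β using Ordinal.limitRecOn with
  | zero => rw [le_zero_iff.1 h]
  | add_one β ih =>
    rcases h.lt_or_eq with h | rfl
    · rw [oscDeriv_succ]
      exact (oscStep_subset _ _ _).trans (ih (Order.lt_add_one_iff.1 h))
    · exact le_rfl
  | limit β hβ ih =>
    rcases h.lt_or_eq with h | rfl
    · rw [oscDeriv_limit f ε hβ]
      exact Set.iInter₂_subset α h
    · exact le_rfl

theorem oscDeriv_mono_scale (f : K → ℝ) {ε δ : ℝ} (h : δ ≤ ε) (α : Ordinal.{u}) :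
    oscDeriv f ε α ⊆ oscDeriv f δ α := by
  induction α using Ordinal.limitRecOn with
  | zero => rw [oscDeriv_zero, oscDeriv_zero]
  | add_one α ih => rw [oscDeriv_succ, oscDeriv_succ]; exact oscStep_mono f h ih
  | limit α hα ih =>
    rw [oscDeriv_limit f _ hα, oscDeriv_limit f _ hα]
    exact Set.iInter₂_mono ih

/-- Every upper estimate of an index comes from here: it suffices to exhibit an ordinal-valued `w`
for which `f` oscillates by less than `ε` near `x` on `{w ≥ w x}`, because each derivation then
removes the points of least remaining rank. -/
theorem oscDeriv_subset_of_rank {f : K → ℝ} {ε : ℝ} (w : K → Ordinal.{u})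
    (hw : ∀ x, ∃ U ∈ 𝓝 x, ∀ y ∈ U, ∀ z ∈ U, w x ≤ w y → w x ≤ w z → |f y - f z| < ε)
    (α : Ordinal.{u}) : oscDeriv f ε α ⊆ {x | α ≤ w x} := by
  induction α using Ordinal.limitRecOn with
  | zero => intro x _; exact zero_le (a := w x)
  | add_one α ih =>
    intro x hx
    rw [oscDeriv_succ, mem_oscStep_iff] at hx
    have h1 : α ≤ w x := ih hx.1
    rw [Set.mem_ofPred_eq, Order.add_one_le_iff]
    refine lt_of_le_of_ne h1 fun heq => ?_
    obtain ⟨U, hU, h⟩ := hw x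
    obtain ⟨y, hy, z, hz, hyP, hzP, hyz⟩ := hx.2 U hU
    exact hyz.not_gt (h y hy z hz (heq ▸ ih hyP) (heq ▸ ih hzP))
  | limit α hα ih =>
    intro x hx
    rw [oscDeriv_limit f ε hα, Set.mem_iInter₂] at hx
    rw [Set.mem_ofPred_eq, hα.le_iff_forall_le]
    exact fun δ hδ => ih δ hδ (hx δ hδ)

theorem oscIndexAt_le_of_eq_empty {f : K → ℝ} {ε : ℝ} {β : Ordinal.{u}} (hβ : β < ω_ 1)
    (h : oscDeriv f ε β = ∅) : oscIndexAt f ε ≤ β := by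
  rw [oscIndexAt, if_pos ⟨β, hβ, h⟩]
  exact csInf_le' h

theorem oscIndexAt_le_of_rank {f : K → ℝ} {ε : ℝ} {β : Ordinal.{u}} (hβ : β < ω_ 1)
    (w : K → Ordinal.{u}) (hwβ : ∀ x, w x < β)
    (hw : ∀ x, ∃ U ∈ 𝓝 x, ∀ y ∈ U, ∀ z ∈ U, w x ≤ w y → w x ≤ w z → |f y - f z| < ε) :
    oscIndexAt f ε ≤ β := by
  refine oscIndexAt_le_of_eq_empty hβ (Set.eq_empty_of_forall_notMem fun x hx => ?_)
  exact (oscDeriv_subset_of_rank w hw β hx).not_gt (hwβ x)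

theorem oscIndexAt_le_oscIndex (f : K → ℝ) {ε : ℝ} (hε : 0 < ε) :
    oscIndexAt f ε ≤ oscIndex f :=
  (isLUB_oscIndex f).1 ⟨ε, hε, rfl⟩

theorem oscIndex_le {f : K → ℝ} {β : Ordinal.{u}} (h : ∀ ε : ℝ, 0 < ε → oscIndexAt f ε ≤ β) :
    oscIndex f ≤ β := by
  refine (isLUB_oscIndex f).2 ?_
  rintro _ ⟨ε, hε, rfl⟩
  exact h ε hε

theorem oscDeriv_oscIndexAt {f : K → ℝ} {ε : ℝ} (h : oscIndexAt f ε < ω_ 1) :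
    oscDeriv f ε (oscIndexAt f ε) = ∅ := by
  by_cases hex : ∃ α : Ordinal.{u}, α < ω_ 1 ∧ oscDeriv f ε α = ∅
  · rw [oscIndexAt, if_pos hex]
    exact csInf_mem (s := {α : Ordinal.{u} | oscDeriv f ε α = ∅}) (hex.imp fun _ h => h.2)
  · rw [oscIndexAt, if_neg hex] at h
    exact h.false.elim

theorem lt_oscIndexAt {f : K → ℝ} {ε : ℝ} {γ : Ordinal.{u}} (hγ : γ < ω_ 1)
    (h : (oscDeriv f ε γ).Nonempty) : γ < oscIndexAt f ε := by
  by_contra! hle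
  have := oscDeriv_antitone f ε hle
  rw [oscDeriv_oscIndexAt (hle.trans_lt hγ)] at this
  exact h.ne_empty (Set.subset_empty_iff.1 this)

/-- The first derived set missing `x` has successor index, since limit stages are intersections; the
rank of `x` is the predecessor. -/
theorem exists_oscRank {f : K → ℝ} {ε : ℝ} {β : Ordinal.{u}} (h : oscDeriv f ε β = ∅) :
    ∃ r : K → Ordinal.{u}, (∀ x, r x < β) ∧ ∀ x α, x ∈ oscDeriv f ε α ↔ α ≤ r x := by
  have key : ∀ x, ∃ ρ < β, ∀ α, x ∈ oscDeriv f ε α ↔ α ≤ ρ := by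
    intro x
    have hex : {α | x ∉ oscDeriv f ε α}.Nonempty := ⟨β, by simp [h]⟩
    set s := sInf {α | x ∉ oscDeriv f ε α} with hs
    have hmem : x ∉ oscDeriv f ε s := csInf_mem hex
    have hlt : ∀ α < s, x ∈ oscDeriv f ε α := fun α hα => by
      by_contra hc
      exact notMem_of_lt_csInf' hα hc
    have hsβ : s ≤ β := csInf_le' (by simp [h])
    clear_value s
    rcases Ordinal.zero_or_succ_or_isSuccLimit s with rfl | ⟨ρ, rfl⟩ | hlim
    · exact (hmem (by simp [oscDeriv_zero])).elim
    · refine ⟨ρ, (lt_add_one ρ).trans_le hsβ, fun α => ⟨fun hα => ?_, fun hα => ?_⟩⟩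
      · by_contra! hc
        exact hmem (oscDeriv_antitone f ε (Order.add_one_le_of_lt hc) hα)
      · exact hlt α (hα.trans_lt (lt_add_one ρ))
    · refine (hmem ?_).elim
      rw [oscDeriv_limit f ε hlim, Set.mem_iInter₂]
      exact hlt
  choose r hr using key
  exact ⟨r, fun x => (hr x).1, fun x => (hr x).2⟩

theorem eventually_le_of_oscRank {f : K → ℝ} {ε : ℝ} {r : K → Ordinal.{u}}
    (hr : ∀ x α, x ∈ oscDeriv f ε α ↔ α ≤ r x) (x : K) : ∀ᶠ y in 𝓝 x, r y ≤ r x := by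
  have hx : x ∈ (oscDeriv f ε (r x + 1))ᶜ := fun h =>
    (lt_add_one (r x)).not_ge ((hr x _).1 h)
  filter_upwards [(isClosed_oscDeriv f ε (r x + 1)).isOpen_compl.mem_nhds hx] with y hy
  by_contra! hc
  exact hy ((hr y _).2 (Order.add_one_le_of_lt hc))

theorem exists_nhds_of_oscRank {f : K → ℝ} {ε : ℝ} {r : K → Ordinal.{u}}
    (hr : ∀ x α, x ∈ oscDeriv f ε α ↔ α ≤ r x) (x : K) :
    ∃ U ∈ 𝓝 x, ∀ y ∈ U, ∀ z ∈ U, r x ≤ r y → r x ≤ r z → |f y - f z| < ε := by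
  have hx : x ∉ oscDeriv f ε (r x + 1) := fun h =>
    (lt_add_one (r x)).not_ge ((hr x _).1 h)
  rw [oscDeriv_succ, mem_oscStep_iff, not_and] at hx
  have := hx ((hr x _).2 le_rfl)
  push Not at this
  obtain ⟨U, hU, h⟩ := this
  exact ⟨U, hU, fun y hy z hz h1 h2 => h y hy z hz ((hr y _).2 h1) ((hr z _).2 h2)⟩

end Oscillation

/-! ### The upper bound for products -/

section Product

variable {K : Type u} [TopologicalSpace K]

theorem exists_productRank {f g : K → ℝ} {ξ η : Ordinal.{u}} (hξ : ξ < ω_ 1) (hη : η < ω_ 1)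
    (hf : oscIndex f ≤ ω ^ ξ) (hg : oscIndex g ≤ ω ^ η) {ε : ℝ} (hε : 0 < ε) :
    ∃ w : K → Ordinal.{u}, (∀ x, w x < ω ^ (η + ξ)) ∧ (∀ x, ∀ᶠ y in 𝓝 x, w y ≤ w x) ∧
      ∀ x, ∃ U ∈ 𝓝 x, ∀ y ∈ U, ∀ z ∈ U, w x ≤ w y → w x ≤ w z → |f y| * |g y - g z| < ε := by
  have hempty : ∀ {k : K → ℝ} {ζ : Ordinal.{u}}, ζ < ω_ 1 → oscIndex k ≤ ω ^ ζ →
      ∀ δ : ℝ, 0 < δ → oscDeriv k δ (ω ^ ζ) = ∅ := by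
    intro k ζ hζ hk δ hδ
    have h1 := (oscIndexAt_le_oscIndex k hδ).trans hk
    have h2 := oscDeriv_oscIndexAt (h1.trans_lt (omega0_opow_lt_omega_one hζ))
    exact Set.subset_empty_iff.1 (h2 ▸ oscDeriv_antitone k δ h1)
  obtain ⟨a, haξ, ha⟩ := exists_oscRank (hempty hξ hf 1 one_pos)
  have hrex : ∀ n : ℕ, ∃ r : K → Ordinal.{u}, (∀ x, r x < ω ^ η) ∧
      ∀ x α, x ∈ oscDeriv g (ε / (n + 1)) α ↔ α ≤ r x := fun n =>
    exists_oscRank (hempty hη hg _ (by positivity))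
  choose r hrη hr using hrex
  have hrmono : ∀ m n : ℕ, m ≤ n → ∀ x, r m x ≤ r n x := by
    intro m n hmn x
    rw [← hr n]
    refine oscDeriv_mono_scale g ?_ _ ((hr m _ _).2 le_rfl)
    gcongr
  have hbd : ∀ x, ∃ n : ℕ, ∀ᶠ y in 𝓝 x, a x ≤ a y → |f y| < n + 1 := by
    intro x
    obtain ⟨U, hU, h⟩ := exists_nhds_of_oscRank ha x
    obtain ⟨n, hn⟩ := exists_nat_ge (|f x|)
    refine ⟨n, ?_⟩
    filter_upwards [hU] with y hy hxy
    have h1 := h y hy x (mem_of_mem_nhds hU) hxy le_rfl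
    have h2 := abs_sub_abs_le_abs_sub (f y) (f x)
    linarith
  classical
  -- Taking the least bound makes `n` upper semicontinuous along each level of `a`: a bound valid
  -- near `x` is also valid near every nearby point of that level.
  let n : K → ℕ := fun x => Nat.find (hbd x)
  have hn : ∀ x, ∀ᶠ y in 𝓝 x, a x ≤ a y → |f y| < n x + 1 := fun x => Nat.find_spec (hbd x)
  have hnle : ∀ x, ∀ᶠ y in 𝓝 x, a y = a x → n y ≤ n x := by
    intro x
    filter_upwards [eventually_eventually_nhds.2 (hn x)] with y hy hyx
    refine Nat.find_min' (hbd y) ?_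
    rwa [hyx]
  have hp : (0 : Ordinal.{u}) < ω ^ η := opow_pos _ omega0_pos
  have hlt : ∀ {c d s t : Ordinal.{u}}, s < ω ^ η → c < d → ω ^ η * c + s < ω ^ η * d + t := by
    intro c d s t hs hcd
    calc ω ^ η * c + s < ω ^ η * c + ω ^ η := by gcongr
      _ = ω ^ η * (c + 1) := by rw [mul_add_one]
      _ ≤ ω ^ η * d := by gcongr; exact Order.add_one_le_of_lt hcd
      _ ≤ _ := le_self_add
  have hrle : ∀ x, ∀ᶠ y in 𝓝 x, a y = a x → r (n y) y ≤ r (n x) y ∧ r (n x) y ≤ r (n x) x := by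
    intro x
    filter_upwards [hnle x, eventually_le_of_oscRank (hr (n x)) x] with y h1 h2 h3
    exact ⟨hrmono _ _ (h1 h3) y, h2⟩
  -- Lexicographic rank: the level of `f` dominates, and `g` is measured at scale `ε / (n x + 1)` to
  -- offset the factor `|f| < n x + 1`.
  refine ⟨fun x => ω ^ η * a x + r (n x) x, fun x => ?_, fun x => ?_, fun x => ?_⟩
  · rw [opow_add]
    have := hlt (t := 0) (hrη (n x) x) (haξ x)
    simpa using this
  · filter_upwards [eventually_le_of_oscRank ha x, hrle x] with y h1 h2
    rcases h1.lt_or_eq with h | h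
    · exact (hlt (hrη _ _) h).le
    · rw [h]
      gcongr
      exact (h2 h).1.trans (h2 h).2
  · obtain ⟨V, hV, hVg⟩ := exists_nhds_of_oscRank (hr (n x)) x
    refine ⟨{y | y ∈ V ∧ a y ≤ a x ∧ (a x ≤ a y → |f y| < n x + 1) ∧
        (a y = a x → r (n y) y ≤ r (n x) y ∧ r (n x) y ≤ r (n x) x)},
      (show ∀ᶠ y in 𝓝 x, y ∈ V from hV).and ((eventually_le_of_oscRank ha x).and ((hn x).and (hrle x))), ?_⟩
    have key : ∀ y, a y ≤ a x → (a y = a x → r (n y) y ≤ r (n x) y ∧ r (n x) y ≤ r (n x) x) →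
        ω ^ η * a x + r (n x) x ≤ ω ^ η * a y + r (n y) y →
        a y = a x ∧ r (n x) x ≤ r (n x) y := by
      intro y h1 h2 h3
      have h4 : a y = a x := h1.eq_of_not_lt fun h => (hlt (hrη _ _) h).not_ge h3
      refine ⟨h4, ?_⟩
      rw [h4] at h3
      exact (le_of_add_le_add_left h3).trans (h2 h4).1
    rintro y ⟨hy, hy1, hy2, hy3⟩ z ⟨hz, hz1, hz2, hz3⟩ hwy hwz
    obtain ⟨hy4, hy5⟩ := key y hy1 hy3 hwy
    obtain ⟨-, hz5⟩ := key z hz1 hz3 hwz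
    have h1 := hy2 hy4.ge
    have h2 := hVg y hy z hz hy5 hz5
    have hpos : (0 : ℝ) < n x + 1 := by positivity
    calc |f y| * |g y - g z| ≤ (n x + 1) * |g y - g z| := by gcongr
      _ < (n x + 1) * (ε / (n x + 1)) := by gcongr
      _ = ε := by field_simp

theorem oscIndex_mul_le {f g : K → ℝ} {ξ₁ ξ₂ : Ordinal.{u}} (hξ₁ : ξ₁ < ω_ 1) (hξ₂ : ξ₂ < ω_ 1)
    (hf : oscIndex f ≤ ω ^ ξ₁) (hg : oscIndex g ≤ ω ^ ξ₂) :
    oscIndex (f * g) ≤ ω ^ max (ξ₁ + ξ₂) (ξ₂ + ξ₁) := by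
  have hξ : max (ξ₁ + ξ₂) (ξ₂ + ξ₁) < ω_ 1 :=
    max_lt (isPrincipal_add_omega 1 hξ₁ hξ₂) (isPrincipal_add_omega 1 hξ₂ hξ₁)
  refine oscIndex_le fun ε hε => ?_
  obtain ⟨v, hvlt, hvle, hv⟩ := exists_productRank hξ₁ hξ₂ hf hg (half_pos hε)
  obtain ⟨w, hwlt, hwle, hw⟩ := exists_productRank hξ₂ hξ₁ hg hf (half_pos hε)
  refine oscIndexAt_le_of_rank (omega0_opow_lt_omega_one hξ) (fun x => natSum (v x) (w x))
    (fun x => natSum_lt_omega0_opow _ _ ?_ _ ?_) fun x => ?_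
  · exact (hvlt x).trans_le (opow_le_opow_right omega0_pos (le_max_right _ _))
  · exact (hwlt x).trans_le (opow_le_opow_right omega0_pos (le_max_left _ _))
  · obtain ⟨U, hU, hUv⟩ := hv x
    obtain ⟨V, hV, hVw⟩ := hw x
    refine ⟨{y | y ∈ U ∧ y ∈ V ∧ v y ≤ v x ∧ w y ≤ w x},
      (show ∀ᶠ y in 𝓝 x, y ∈ U from hU).and
        ((show ∀ᶠ y in 𝓝 x, y ∈ V from hV).and ((hvle x).and (hwle x))), ?_⟩
    rintro y ⟨hyU, hyV, hy1, hy2⟩ z ⟨hzU, hzV, hz1, hz2⟩ hy hz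
    obtain ⟨hy3, hy4⟩ := eq_of_natSum_le hy1 hy2 hy
    obtain ⟨hz3, hz4⟩ := eq_of_natSum_le hz1 hz2 hz
    have h1 := hUv y hyU z hzU hy3.ge hz3.ge
    -- The roles of `y` and `z` are exchanged so that the factor is `g z`, as the decomposition `h4`
    -- requires.
    have h2 := hVw z hzV y hyV hz4.ge hy4.ge
    rw [← abs_mul] at h1 h2
    have h3 := abs_sub (f y * (g y - g z)) (g z * (f z - f y))
    have h4 : (f * g) y - (f * g) z = f y * (g y - g z) - g z * (f z - f y) := by
      simp only [Pi.mul_apply]; ring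
    rw [h4]
    linarith

end Product

/-! ### Scattered sets of prescribed rank -/

/-- A function `ρ` behaves like one plus the Cantor–Bendixson rank of a countable closed scattered
set, extended by zero outside of that set. -/
structure IsScatteredRank {K : Type u} [TopologicalSpace K] (ρ : K → Ordinal.{u}) : Prop where
  eventually_lt : ∀ x, ∀ᶠ y in 𝓝 x, y ≠ x → ρ y ≠ 0 → ρ y < ρ x
  frequently_eq : ∀ x, ∀ β ≠ 0, β < ρ x → ∃ᶠ y in 𝓝 x, ρ y = β
  countable_support : {x | ρ x ≠ 0}.Countable

section Existence

variable {K : Type u} [MetricSpace K]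

theorem frequently_ne_mem_iteratedDerivedSet {α β : Ordinal.{u}} (h : β < α) {x : K}
    (hx : x ∈ CantorBendixson.iteratedDerivedSet (Set.univ : Set K) α) :
    ∃ᶠ y in 𝓝 x, y ≠ x ∧ y ∈ CantorBendixson.iteratedDerivedSet (Set.univ : Set K) β := by
  have h1 := CantorBendixson.iteratedDerivedSet_antitone _ (Order.add_one_le_of_lt h) hx
  rw [CantorBendixson.iteratedDerivedSet_succ, relDerivedSet_apply] at h1
  exact accPt_iff_frequently.1 h1.1

theorem countable_Iio_of_lt_omega_one {α : Ordinal.{u}} (hα : α < ω_ 1) :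
    (Set.Iio α).Countable := by
  rw [← Cardinal.le_aleph0_iff_set_countable, Cardinal.mk_Iio_ordinal,
    ← Cardinal.lift_aleph0.{u + 1, u}, Cardinal.lift_le]
  rwa [← Order.lt_succ_iff, Cardinal.succ_aleph0, ← Cardinal.lt_ord, Cardinal.ord_aleph]

theorem exists_seq_frequently_eq {α : Ordinal.{u}} (hα : α < ω_ 1) (h0 : α ≠ 0) :
    ∃ s : ℕ → Ordinal.{u}, (∀ n, s n < α) ∧ ∀ β < α, ∃ᶠ n in atTop, s n = β := by
  have hc : Countable (Set.Iio α) := countable_Iio_of_lt_omega_one hα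
  have : Nonempty (Set.Iio α) := ⟨⟨0, pos_iff_ne_zero.2 h0⟩⟩
  -- Reading only the first coordinate of the pairing repeats every value infinitely often.
  obtain ⟨e, he⟩ := exists_surjective_nat (Set.Iio α)
  refine ⟨fun n => (e n.unpair.1).1, fun n => (e n.unpair.1).2, fun β hβ => ?_⟩
  obtain ⟨k, hk⟩ := he ⟨β, hβ⟩
  rw [frequently_atTop]
  intro m
  refine ⟨Nat.pair k m, Nat.right_le_pair k m, ?_⟩
  simp [hk]

theorem exists_approaching_seq {x : K} {p : ℕ → K → Prop}
    (hp : ∀ n, ∃ᶠ y in 𝓝 x, y ≠ x ∧ p n y) {r : ℝ} (hr : 0 < r) :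
    ∃ (y : ℕ → K) (R : ℕ → ℝ), (∀ n, p n (y n)) ∧ (∀ n, 0 < R n) ∧ R 0 = r ∧
      (∀ n, R (n + 1) < dist (y n) x) ∧ (∀ n, dist (y n) x < R n) ∧ Antitone R ∧
      Tendsto R atTop (𝓝 0) := by
  have step : ∀ n, ∀ t : ℝ, 0 < t → ∃ y, p n y ∧ 0 < dist y x ∧ dist y x < t := by
    intro n t ht
    obtain ⟨y, ⟨h1, h2⟩, h3⟩ := ((hp n).and_eventually (Metric.ball_mem_nhds x ht)).exists
    exact ⟨y, h2, dist_pos.2 h1, h3⟩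
  have : Nonempty K := ⟨x⟩
  choose! Y hY1 hY2 hY3 using step
  let R : ℕ → ℝ := fun n => Nat.rec r (fun n t => dist (Y n t) x / 2) n
  have hR : ∀ n, R (n + 1) = dist (Y n (R n)) x / 2 := fun n => rfl
  have hpos : ∀ n, 0 < R n := by
    intro n
    induction n with
    | zero => exact hr
    | succ n ih => rw [hR]; exact half_pos (hY2 n _ ih)
  have hhalf : ∀ n, R (n + 1) ≤ R n * (1 / 2) := fun n => by
    rw [hR]
    have := hY3 n _ (hpos n)
    linarith
  refine ⟨fun n => Y n (R n), R, fun n => hY1 n _ (hpos n), hpos, rfl, fun n => ?_,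
    fun n => hY3 n _ (hpos n), antitone_nat_of_succ_le fun n => ?_, ?_⟩
  · rw [hR]
    exact half_lt_self (hY2 n _ (hpos n))
  · have := hhalf n
    have := hpos n
    linarith
  · have hle : ∀ n, R n ≤ r * (1 / 2) ^ n := by
      intro n
      induction n with
      | zero => simp [R]
      | succ n ih =>
        calc R (n + 1) ≤ R n * (1 / 2) := hhalf n
          _ ≤ r * (1 / 2) ^ n * (1 / 2) := by gcongr
          _ = _ := by ring
    refine squeeze_zero (fun n => (hpos n).le) hle ?_
    simpa using (tendsto_pow_atTop_nhds_zero_of_lt_one (r := (1 / 2 : ℝ)) (by norm_num)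
      (by norm_num)).const_mul r

/-- Points converging to `x` are chosen in disjoint annuli, with ranks running through every `β < α`
infinitely often. The sets given by induction inside these annuli are glued, and `x` is added on
top. -/
theorem exists_isScatteredRank (α : Ordinal.{u}) (hα : α < ω_ 1) :
    ∀ x ∈ CantorBendixson.iteratedDerivedSet (Set.univ : Set K) α, ∀ U ∈ 𝓝 x,
      ∃ ρ : K → Ordinal.{u}, IsScatteredRank ρ ∧ ρ x = 1 + α ∧ (∀ y, ρ y ≤ 1 + α) ∧
        ∀ y, ρ y ≠ 0 → y ∈ U := by
  classical
  induction α using WellFoundedLT.induction with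
  | ind α ih =>
  intro x hx U hU
  have h1α : 1 + α ≠ 0 := by simp
  rcases eq_or_ne α 0 with rfl | h0
  · refine ⟨fun y => if y = x then 1 else 0, ⟨fun y => ?_, fun y β hβ hlt => ?_, ?_⟩,
      by simp, fun y => ?_, fun y hy => ?_⟩
    · rcases eq_or_ne y x with rfl | hyx
      · exact .of_forall fun z hz h => by simp [hz] at h
      · filter_upwards [isOpen_ne.mem_nhds hyx] with z hz _ h
        simp [hz] at h
    · split_ifs at hlt <;> simp_all
    · refine (Set.countable_singleton x).mono fun y hy => ?_
      by_contra hc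
      simp_all
    · simp only [add_zero]; split_ifs <;> simp
    · have : y = x := by by_contra hc; simp_all
      exact this ▸ mem_of_mem_nhds hU
  obtain ⟨s, hsα, hs⟩ := exists_seq_frequently_eq hα h0
  obtain ⟨r, hr, hrU⟩ := Metric.mem_nhds_iff.1 hU
  obtain ⟨y, R, hy, hRpos, hR0, hRy, hyR, hRanti, hRlim⟩ := exists_approaching_seq
    (fun n => frequently_ne_mem_iteratedDerivedSet (hsα n) hx) hr
  have hVn : ∀ n, {z | R (n + 1) < dist z x ∧ dist z x < R n} ∈ 𝓝 (y n) := fun n =>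
    ((isOpen_lt continuous_const (continuous_id.dist continuous_const)).inter
      (isOpen_lt (continuous_id.dist continuous_const) continuous_const)).mem_nhds
        ⟨hRy n, hyR n⟩
  choose σ hσ hσy hσle hσV using fun n => ih (s n) (hsα n) ((hsα n).trans hα) (y n) (hy n) _ (hVn n)
  have hdisj : ∀ m n z, σ m z ≠ 0 → σ n z ≠ 0 → m = n := by
    have aux : ∀ m n z, m < n → σ m z ≠ 0 → σ n z ≠ 0 → False := by
      intro m n z hmn hm hn
      have h1 := (hσV m z hm).1
      have h2 := (hσV n z hn).2
      have h3 := hRanti (Nat.succ_le_of_lt hmn)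
      simp only [Nat.succ_eq_add_one] at h3
      linarith
    intro m n z hm hn
    rcases lt_trichotomy m n with h | h | h
    · exact (aux m n z h hm hn).elim
    · exact h
    · exact (aux n m z h hn hm).elim
  have hσx : ∀ n, σ n x = 0 := fun n => by
    by_contra hc
    have h1 := (hσV n x hc).1
    rw [dist_self] at h1
    exact h1.not_gt (hRpos (n + 1))
  -- Away from `x` at most one term of the supremum is nonzero, by `hdisj`.
  let ρ : K → Ordinal.{u} := fun z => if z = x then 1 + α else ⨆ n, σ n z
  have hρx : ρ x = 1 + α := if_pos rfl
  have hρne : ∀ z, z ≠ x → ρ z = ⨆ n, σ n z := fun z hz => if_neg hz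
  have hσρ : ∀ n z, σ n z ≠ 0 → ρ z = σ n z := by
    intro n z hz
    have hzx : z ≠ x := fun h => hz (h ▸ hσx n)
    rw [hρne z hzx]
    refine le_antisymm (Ordinal.iSup_le fun m => ?_) (Ordinal.le_iSup (fun n => σ n z) n)
    rcases eq_or_ne (σ m z) 0 with h | h
    · simp [h]
    · rw [hdisj m n z h hz]
  have hσleρ : ∀ n z, σ n z ≤ ρ z := by
    intro n z
    rcases eq_or_ne (σ n z) 0 with h | h
    · simp [h]
    · exact (hσρ n z h).ge
  have hρσ : ∀ z, z ≠ x → ρ z ≠ 0 → ∃ n, σ n z ≠ 0 := by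
    intro z hz h
    by_contra! hc
    exact h (by rw [hρne z hz]; simp [hc])
  have hlt : ∀ n, 1 + s n < 1 + α := fun n => by gcongr; exact hsα n
  have hρlt : ∀ z, z ≠ x → ρ z < 1 + α := by
    intro z hz
    rcases eq_or_ne (ρ z) 0 with h | h
    · rw [h]; exact pos_iff_ne_zero.2 h1α
    · obtain ⟨n, hn⟩ := hρσ z hz h
      rw [hσρ n z hn]
      exact (hσle n z).trans_lt (hlt n)
  refine ⟨ρ, ⟨fun z => ?_, fun z β hβ hlt' => ?_, ?_⟩, hρx, fun z => ?_, fun z hz => ?_⟩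
  · rcases eq_or_ne z x with rfl | hzx
    · exact .of_forall fun w hw _ => hρx ▸ hρlt w hw
    · have hd : 0 < dist z x := dist_pos.2 hzx
      obtain ⟨m, hm⟩ := (hRlim.eventually_lt_const hd).exists
      have hev : ∀ᶠ w in 𝓝 z, R m < dist w x :=
        (isOpen_lt continuous_const (continuous_id.dist continuous_const)).mem_nhds hm
      -- A point other than `x` has a neighbourhood meeting only finitely many of the annuli.
      have hfin : ∀ᶠ w in 𝓝 z, ∀ n ∈ Finset.range m, w ≠ z → σ n w ≠ 0 → σ n w < σ n z :=
        (Finset.eventually_all _).2 fun n _ => (hσ n).eventually_lt z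
      filter_upwards [hev, hfin] with w h1 h2 hwz hw0
      have hwx : w ≠ x := by
        rintro rfl
        rw [dist_self] at h1
        exact h1.not_gt (hRpos m)
      obtain ⟨n, hn⟩ := hρσ w hwx hw0
      have hnm : n < m := by
        by_contra! hc
        have h3 := (hσV n w hn).2
        have h4 := hRanti hc
        linarith
      rw [hσρ n w hn]
      exact (h2 n (Finset.mem_range.2 hnm) hwz hn).trans_le (hσleρ n z)
  · rcases eq_or_ne z x with rfl | hzx
    · rw [hρx] at hlt'
      have hβ1 : 1 ≤ β := Order.one_le_iff_ne_zero.2 hβ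
      have hβeq : 1 + (β - 1) = β := Ordinal.add_sub_cancel_of_le hβ1
      have hβα : β - 1 < α := by
        rw [← hβeq] at hlt'
        exact lt_of_add_lt_add_left hlt'
      have hylim : Tendsto y atTop (𝓝 z) :=
        tendsto_iff_dist_tendsto_zero.2
          (squeeze_zero (fun _ => dist_nonneg) (fun n => (hyR n).le) hRlim)
      refine hylim.frequently ((hs _ hβα).mono fun n hn => ?_)
      have : σ n (y n) = β := by rw [hσy, hn, hβeq]
      rw [hσρ n (y n) (this ▸ hβ), this]
    · obtain ⟨n, hn⟩ := hρσ z hzx (fun h => by simp [h] at hlt')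
      rw [hσρ n z hn] at hlt'
      refine ((hσ n).frequently_eq z β hβ hlt').mono fun w hw => ?_
      rw [hσρ n w (hw ▸ hβ), hw]
  · refine ((Set.countable_singleton x).union
      (Set.countable_iUnion fun n => (hσ n).countable_support)).mono fun z hz => ?_
    rcases eq_or_ne z x with h | h
    · exact Or.inl h
    · exact Or.inr (Set.mem_iUnion.2 (hρσ z h hz))
  · rcases eq_or_ne z x with rfl | h
    · exact hρx.le
    · exact (hρlt z h).le
  · rcases eq_or_ne z x with rfl | h
    · exact mem_of_mem_nhds hU
    · obtain ⟨n, hn⟩ := hρσ z h hz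
      apply hrU
      have h1 := (hσV n z hn).2
      have h2 := hRanti (Nat.zero_le n)
      rw [Metric.mem_ball]
      linarith

end Existence

/-! ### Baire-one functions and blow-up functions -/

section BaireOne

variable {K : Type u} [MetricSpace K]

theorem exists_continuous_eqOn_finset (f : K → ℝ) {A : Set K} (hA : IsClosed A) (T : Finset K)
    (hAT : ∀ t ∈ T, t ∉ A) :
    ∃ F : K → ℝ, Continuous F ∧ (∀ t ∈ T, F t = f t) ∧ ∀ x ∈ A, F x = 0 := by
  classical
  induction T using Finset.induction_on with
  | empty => exact ⟨fun _ => 0, continuous_const, by simp, by simp⟩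
  | insert t T ht ih =>
    obtain ⟨F, hF, hFT, hFA⟩ := ih fun s hs => hAT s (Finset.mem_insert_of_mem hs)
    have hdisj : Disjoint (A ∪ (T : Set K)) {t} := by
      rw [Set.disjoint_singleton_right]
      rintro (h | h)
      · exact hAT t (Finset.mem_insert_self t T) h
      · exact ht h
    obtain ⟨ψ, hψ0, hψ1, -⟩ := exists_continuous_zero_one_of_isClosed
      (hA.union T.finite_toSet.isClosed) isClosed_singleton hdisj
    refine ⟨fun x => F x + (f t - F t) * ψ x, by fun_prop, fun s hs => ?_, fun x hx => ?_⟩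
    · rcases Finset.mem_insert.1 hs with rfl | hs
      · simp [hψ1 (Set.mem_singleton s)]
      · simp [hψ0 (Or.inr hs : s ∈ A ∪ (T : Set K)), hFT s hs]
    · simp [hψ0 (Or.inl hx : x ∈ A ∪ (T : Set K)), hFA x hx]

/-- The `n`-th approximant matches `f` at the first `n` points of an enumeration of `C` and vanishes
at distance at least `1 / (n + 1)` from `C`. -/
theorem isBaireOne_of_countable_closed {f : K → ℝ} {C : Set K} (hC : IsClosed C)
    (hcount : C.Countable) (hf : ∀ x ∉ C, f x = 0) : IsBaireOne f := by
  classical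
  rcases C.eq_empty_or_nonempty with rfl | hne
  · refine ⟨fun _ _ => 0, fun _ => continuous_const, fun x => ?_⟩
    rw [hf x (Set.notMem_empty x)]
    exact tendsto_const_nhds
  obtain ⟨e, rfl⟩ := hcount.exists_eq_range hne
  have h : ∀ n : ℕ, ∃ F : K → ℝ, Continuous F ∧ (∀ t ∈ (Finset.range n).image e, F t = f t) ∧
      ∀ x ∈ {x | 1 / ((n : ℝ) + 1) ≤ Metric.infDist x (Set.range e)}, F x = 0 := by
    intro n
    refine exists_continuous_eqOn_finset f
      (isClosed_le continuous_const (Metric.continuous_infDist_pt _)) _ fun t ht hA => ?_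
    obtain ⟨i, -, rfl⟩ := Finset.mem_image.1 ht
    rw [Set.mem_ofPred_eq, Metric.infDist_zero_of_mem (Set.mem_range_self i)] at hA
    exact hA.not_gt Nat.one_div_pos_of_nat
  choose F hF hFe hF0 using h
  refine ⟨F, hF, fun x => ?_⟩
  by_cases hx : x ∈ Set.range e
  · obtain ⟨i, rfl⟩ := hx
    refine tendsto_const_nhds.congr' ?_
    filter_upwards [eventually_gt_atTop i] with n hn
    exact (hFe n _ (Finset.mem_image_of_mem e (Finset.mem_range.2 hn))).symm
  · rw [hf x hx]
    have hpos := (hC.notMem_iff_infDist_pos hne).1 hx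
    refine tendsto_const_nhds.congr' ?_
    filter_upwards [tendsto_one_div_add_atTop_nhds_zero_nat.eventually_lt_const hpos] with n hn
    exact (hF0 n x hn.le).symm

theorem exists_blowup_function {D : Set K} (hD : IsClosed D) :
    ∃ φ : K → ℝ, (∀ x, 1 ≤ φ x) ∧ (∀ x ∉ D, ContinuousAt φ x) ∧
      ∀ x ∈ D, ∀ c : ℝ, ∀ᶠ y in 𝓝 x, y ∉ D → c < φ y := by
  rcases D.eq_empty_or_nonempty with rfl | hne
  · exact ⟨fun _ => 1, fun _ => le_rfl, fun _ _ => continuousAt_const, by simp⟩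
  refine ⟨fun x => 1 + (Metric.infDist x D)⁻¹, fun x => ?_, fun x hx => ?_, fun x hx c => ?_⟩
  · have : 0 ≤ (Metric.infDist x D)⁻¹ := inv_nonneg.2 Metric.infDist_nonneg
    linarith
  · exact continuousAt_const.add ((Metric.continuous_infDist_pt D).continuousAt.inv₀
      ((hD.notMem_iff_infDist_pos hne).1 hx).ne')
  · have h0 : Tendsto (fun y => Metric.infDist y D) (𝓝 x) (𝓝 0) := by
      simpa [Metric.infDist_zero_of_mem hx] using (Metric.continuous_infDist_pt D).tendsto x
    have hc : (0 : ℝ) < (|c| + 1)⁻¹ := by positivity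
    filter_upwards [h0.eventually_lt_const hc] with y hy hyD
    have hpos := (hD.notMem_iff_infDist_pos hne).1 hyD
    have h1 : |c| + 1 < (Metric.infDist y D)⁻¹ := by
      rwa [lt_inv_comm₀ (by positivity) hpos]
    have := le_abs_self c
    linarith

end BaireOne

/-! ### Parity of a scattered rank -/

/-- The parity of an ordinal, as a real number. -/
noncomputable def ordinalParity (α : Ordinal.{u}) : ℝ := if α % 2 = 0 then 0 else 1

@[simp]
theorem ordinalParity_zero : ordinalParity (0 : Ordinal.{u}) = 0 := by simp [ordinalParity]

theorem ordinalParity_nonneg (α : Ordinal.{u}) : 0 ≤ ordinalParity α := by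
  unfold ordinalParity; split_ifs <;> norm_num

theorem ordinalParity_le_one (α : Ordinal.{u}) : ordinalParity α ≤ 1 := by
  unfold ordinalParity; split_ifs <;> norm_num

theorem abs_ordinalParity_add_one_sub (α : Ordinal.{u}) :
    |ordinalParity (α + 1) - ordinalParity α| = 1 := by
  have h2 : α % 2 < 1 + 1 := by
    rw [one_add_one_eq_two]
    exact mod_lt α two_ne_zero
  have hd : 2 * (α / 2) + α % 2 = α := div_add_mod α 2
  have h : α % 2 = 0 ∨ α % 2 = 1 := by
    rw [Order.lt_add_one_iff] at h2
    rcases h2.lt_or_eq with h | h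
    · exact Or.inl (Order.lt_one_iff.1 h)
    · exact Or.inr h
  have h3 : (α + 1) % 2 = (α % 2 + 1) % 2 := by
    conv_lhs => rw [← hd, add_assoc, mul_add_mod_self]
  unfold ordinalParity
  rcases h with h | h
  · rw [h3, h, zero_add, mod_eq_of_lt (by exact_mod_cast one_lt_two)]
    norm_num
  · rw [h3, h, one_add_one_eq_two, mod_self]
    norm_num

namespace IsScatteredRank

variable {K : Type u} [TopologicalSpace K] {ρ : K → Ordinal.{u}}

theorem eventually_le (h : IsScatteredRank ρ) (x : K) : ∀ᶠ y in 𝓝 x, ρ y ≤ ρ x := by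
  filter_upwards [h.eventually_lt x] with y hy
  rcases eq_or_ne y x with rfl | hyx
  · exact le_rfl
  rcases eq_or_ne (ρ y) 0 with h0 | h0
  · rw [h0]; exact bot_le
  · exact (hy hyx h0).le

theorem isClosed_le (h : IsScatteredRank ρ) (α : Ordinal.{u}) : IsClosed {x | α ≤ ρ x} := by
  refine isOpen_compl_iff.1 (isOpen_iff_mem_nhds.2 fun x hx => ?_)
  filter_upwards [h.eventually_le x] with y hy hc
  exact hx (le_trans hc hy)

theorem isClosed_support (h : IsScatteredRank ρ) : IsClosed {x | ρ x ≠ 0} := by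
  simpa [Order.one_le_iff_ne_zero] using h.isClosed_le 1

/-- A point of rank at least `1 + α + 1` has points of ranks `1 + α` and `1 + α + 1` in every
neighbourhood, and their parities differ. The offset `1` keeps these ranks nonzero. -/
theorem le_oscDeriv_parity (h : IsScatteredRank ρ) (α : Ordinal.{u}) :
    {x | 1 + α ≤ ρ x} ⊆ oscDeriv (fun x => ordinalParity (ρ x)) 1 α := by
  induction α using Ordinal.limitRecOn with
  | zero => rw [oscDeriv_zero]; exact Set.subset_univ _
  | add_one α ih =>
    intro x hx
    rw [Set.mem_ofPred_eq, ← add_assoc] at hx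
    have hlt : 1 + α < ρ x := (lt_add_one _).trans_le hx
    rw [oscDeriv_succ, mem_oscStep_iff]
    refine ⟨ih hlt.le, fun U hU => ?_⟩
    have hfreq : ∀ β ≠ 0, β ≤ ρ x → ∃ y ∈ U, ρ y = β := by
      intro β hβ hle
      rcases hle.lt_or_eq with hlt | rfl
      · obtain ⟨y, hy, hyU⟩ := ((h.frequently_eq x β hβ hlt).and_eventually hU).exists
        exact ⟨y, hyU, hy⟩
      · exact ⟨x, mem_of_mem_nhds hU, rfl⟩
    obtain ⟨y, hyU, hy⟩ := hfreq (1 + α + 1) (by simp) hx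
    obtain ⟨z, hzU, hz⟩ := hfreq (1 + α) (by simp) hlt.le
    refine ⟨y, hyU, z, hzU, ih ?_, ih hz.ge, ?_⟩
    · rw [Set.mem_ofPred_eq, hy]; exact (lt_add_one _).le
    · rw [hy, hz]; exact (abs_ordinalParity_add_one_sub _).ge
  | limit α hα ih =>
    intro x hx
    rw [oscDeriv_limit _ _ hα, Set.mem_iInter₂]
    exact fun δ hδ => ih δ hδ (le_trans (show 1 + δ ≤ 1 + α by gcongr) hx)

theorem oscIndex_parity_le (h : IsScatteredRank ρ) {β : Ordinal.{u}} (hβ : β < ω_ 1)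
    (hρ : ∀ x, ρ x < β) : oscIndex (fun x => ordinalParity (ρ x)) ≤ β := by
  refine oscIndex_le fun ε hε => oscIndexAt_le_of_rank hβ ρ hρ fun x => ?_
  refine ⟨_, h.eventually_lt x, fun y hy z hz hxy hxz => ?_⟩
  rcases eq_or_ne (ρ x) 0 with h0 | h0
  · have : ∀ w, (w ≠ x → ρ w ≠ 0 → ρ w < ρ x) → ρ w = 0 := by
      intro w hw
      by_contra hc
      have hwx : w ≠ x := fun h => hc (h ▸ h0)
      have := hw hwx hc
      simp [h0] at this
    rw [this y hy, this z hz]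
    simpa
  · have : ∀ w, (w ≠ x → ρ w ≠ 0 → ρ w < ρ x) → ρ x ≤ ρ w → w = x := by
      intro w hw hxw
      by_contra hc
      exact (hw hc (fun h => h0 (by simpa [h] using hxw))).not_ge hxw
    rw [this y hy hxy, this z hz hxz]
    simpa

end IsScatteredRank

/-! ### Factoring the parity function -/

section Factorization

variable {K : Type u} [MetricSpace K]

theorem IsScatteredRank.isBaireOne {ρ : K → Ordinal.{u}} (h : IsScatteredRank ρ) {f : K → ℝ}
    (hf : ∀ x, ρ x = 0 → f x = 0) : IsBaireOne f :=
  isBaireOne_of_countable_closed h.isClosed_support h.countable_support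
    fun x hx => hf x (not_not.1 hx)

theorem exists_injOn_nat {δ : Ordinal.{u}} (hδ : δ < ω_ 1) :
    ∃ e : Ordinal.{u} → ℕ, Set.InjOn e (Set.Iio δ) := by
  exact Set.countable_iff_exists_injOn.1 (countable_Iio_of_lt_omega_one hδ)

/-- A layer function that is continuous on every block of ranks `[p * c, p * (c + 1))`, and whose
sublevel sets meet, near every point, no block other than the one of that point. -/
theorem IsScatteredRank.exists_layer_function {ρ : K → Ordinal.{u}} (h : IsScatteredRank ρ)
    {p δ : Ordinal.{u}} (hp : p ≠ 0) (hδ : δ < ω_ 1) (hρ : ∀ x, ρ x / p < δ) :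
    ∃ N : K → ℝ, (∀ x, 0 < N x) ∧
      (∀ x, ∃ M : K → ℝ, ContinuousAt M x ∧ ∀ y, ρ y / p = ρ x / p → N y = M y) ∧
      ∀ x, ∀ c : ℝ, ∀ᶠ y in 𝓝 x, ρ y ≠ 0 → N y ≤ c → ρ y / p = ρ x / p := by
  obtain ⟨e, he⟩ := exists_injOn_nat hδ
  choose φ hφ1 hφc hφb using fun a : Ordinal.{u} =>
    exists_blowup_function (h.isClosed_le (p * (a + 1)))
  have hlt : ∀ x, ρ x < p * (ρ x / p + 1) := fun x => by
    rw [← Order.succ_eq_add_one]; exact lt_mul_succ_div _ hp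
  have hN : ∀ x a, 1 ≤ (e a + 1 : ℝ) ∧ 1 ≤ φ a x := fun x a => ⟨by simp, hφ1 a x⟩
  -- Injectivity of `e` leaves finitely many blocks where `N ≤ c` is possible; each of these below
  -- the block of `x` is excluded near `x` by the blow-up of its `φ`.
  refine ⟨fun x => (e (ρ x / p) + 1) * φ (ρ x / p) x, fun x => ?_, fun x => ?_, fun x c => ?_⟩
  · have := hφ1 (ρ x / p) x
    positivity
  · refine ⟨fun y => (e (ρ x / p) + 1) * φ (ρ x / p) y,
      continuousAt_const.mul (hφc _ x fun hx => (hlt x).not_ge hx), fun y hy => ?_⟩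
    simp only [hy]
  · have hfin : (Set.Iio δ ∩ {a | (e a : ℝ) + 1 ≤ c}).Finite := by
      refine Set.Finite.of_finite_image (f := e)
        ((Set.finite_le_nat ⌊c⌋₊).subset ?_) (he.mono Set.inter_subset_left)
      rintro _ ⟨a, ⟨-, ha⟩, rfl⟩
      refine Nat.le_floor ?_
      have : (e a : ℝ) + 1 ≤ c := ha
      linarith
    have hev : ∀ a ∈ Set.Iio δ ∩ {a | (e a : ℝ) + 1 ≤ c}, ∀ᶠ y in 𝓝 x,
        a < ρ x / p → ρ y < p * (a + 1) → c < φ a y := by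
      intro a _
      by_cases ha : a < ρ x / p
      · have hx : p * (a + 1) ≤ ρ x :=
          (mul_le_mul_right (Order.add_one_le_of_lt ha) p).trans (mul_div_le _ _)
        filter_upwards [hφb a x hx c] with y hy _ hlt
        exact hy hlt.not_ge
      · exact .of_forall fun y h => (ha h).elim
    filter_upwards [(hfin.eventually_all).2 hev, h.eventually_le x] with y h1 h2 _ hyc
    by_contra hne
    have h3 : ρ y / p < ρ x / p := (div_le_left h2 p).lt_of_ne hne
    obtain ⟨h4, h5⟩ := hN y (ρ y / p)
    have h6 : (e (ρ y / p) : ℝ) + 1 ≤ c := (le_mul_of_one_le_right (by linarith) h5).trans hyc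
    have h7 := h1 (ρ y / p) ⟨hρ y, h6⟩ h3 (hlt y)
    have h8 : φ (ρ y / p) y ≤ c := (le_mul_of_one_le_left (by linarith) h4).trans hyc
    linarith

theorem IsScatteredRank.exists_factorization {ρ : K → Ordinal.{u}} (h : IsScatteredRank ρ)
    {ξ η : Ordinal.{u}} (hξ0 : ξ ≠ 0) (hη0 : η ≠ 0) (hξ : ξ < ω_ 1) (hη : η < ω_ 1)
    (hρ : ∀ x, ρ x < ω ^ (ξ + η)) :
    ∃ f ∈ smallBaireClass K ξ, ∃ g ∈ smallBaireClass K η,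
      f * g = fun x => ordinalParity (ρ x) := by
  classical
  have hp : (ω : Ordinal.{u}) ^ ξ ≠ 0 := opow_ne_zero _ omega0_ne_zero
  have hpl : Order.IsSuccLimit ((ω : Ordinal.{u}) ^ ξ) :=
    isSuccLimit_opow_left isSuccLimit_omega0 hξ0
  have hql : Order.IsSuccLimit ((ω : Ordinal.{u}) ^ η) :=
    isSuccLimit_opow_left isSuccLimit_omega0 hη0
  have hdiv : ∀ x, ρ x / ω ^ ξ < ω ^ η := fun x => by
    rw [← Ordinal.lt_mul_iff_div_lt hp, ← opow_add]
    exact hρ x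
  obtain ⟨N, hN0, hNc, hNe⟩ := h.exists_layer_function hp (omega0_opow_lt_omega_one hη) hdiv
  have hloc : ∀ x, ∀ᶠ y in 𝓝 x, ρ y / ω ^ ξ = ρ x / ω ^ ξ → y ≠ x → ρ y ≠ 0 →
      ρ y % ω ^ ξ < ρ x % ω ^ ξ := by
    intro x
    filter_upwards [h.eventually_lt x] with y hy h1 h2 h3
    have h4 := hy h2 h3
    rw [← div_add_mod (ρ y) (ω ^ ξ), ← div_add_mod (ρ x) (ω ^ ξ), h1] at h4
    exact lt_of_add_lt_add_left h4
  refine ⟨fun x => ordinalParity (ρ x) / N x, ⟨h.isBaireOne fun x hx => by simp [hx], ?_⟩,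
    fun x => if ρ x = 0 then 0 else N x, ⟨h.isBaireOne fun x hx => if_pos hx, ?_⟩, ?_⟩
  · refine oscIndex_le fun ε hε => oscIndexAt_le_of_rank (omega0_opow_lt_omega_one hξ)
      -- Where `N > 1 / ε` the quotient lies in `[0, ε)`, so rank `0` suffices. The remaining points
      -- near `x` lie in its block, where the remainder of `ρ` decreases strictly away from `x`.
      (fun x => if ρ x ≠ 0 ∧ N x ≤ 1 / ε then ρ x % ω ^ ξ + 1 else 0) (fun x => ?_) fun x => ?_
    · split_ifs
      · exact hpl.add_one_lt (mod_lt _ hp)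
      · exact opow_pos _ omega0_pos
    · have hbase : ∀ᶠ y in 𝓝 x, y ≠ x → ρ y ≠ 0 → N y ≤ 1 / ε →
          ρ y % ω ^ ξ < ρ x % ω ^ ξ ∧ ρ y / ω ^ ξ = ρ x / ω ^ ξ := by
        filter_upwards [hNe x (1 / ε), hloc x] with y h1 h2 h3 h4 h5
        exact ⟨h2 (h1 h4 h5) h3 h4, h1 h4 h5⟩
      by_cases hx : ρ x ≠ 0 ∧ N x ≤ 1 / ε
      · have key : ∀ w, (w ≠ x → ρ w ≠ 0 → N w ≤ 1 / ε →
            ρ w % ω ^ ξ < ρ x % ω ^ ξ ∧ ρ w / ω ^ ξ = ρ x / ω ^ ξ) →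
            ρ x % ω ^ ξ + 1 ≤ (if ρ w ≠ 0 ∧ N w ≤ 1 / ε then ρ w % ω ^ ξ + 1 else 0) →
            w = x := by
          intro w hw hle
          by_contra hwx
          split_ifs at hle with hc
          · exact (hw hwx hc.1 hc.2).1.not_ge (by simpa using hle)
          · simp at hle
        refine ⟨_, hbase, fun y hy z hz hxy hxz => ?_⟩
        rw [if_pos hx] at hxy hxz
        rw [key y hy hxy, key z hz hxz]
        simpa
      · have hsmall : ∀ᶠ y in 𝓝 x, ¬ (ρ y ≠ 0 ∧ N y ≤ 1 / ε) := by
          rcases eq_or_ne (ρ x) 0 with h0 | h0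
          · filter_upwards [h.eventually_le x] with y hy hc
            exact hc.1 (by simpa [h0] using hy)
          · have hNx : 1 / ε < N x := by
              by_contra! hc
              exact hx ⟨h0, hc⟩
            obtain ⟨M, hM, hNM⟩ := hNc x
            rw [hNM x rfl] at hNx
            filter_upwards [hM.eventually_const_lt hNx, hNe x (1 / ε)] with y h1 h2 hc
            have h3 := h2 hc.1 hc.2
            rw [← hNM y h3] at h1
            exact h1.not_ge hc.2
        have key : ∀ w, ¬ (ρ w ≠ 0 ∧ N w ≤ 1 / ε) →
            0 ≤ ordinalParity (ρ w) / N w ∧ ordinalParity (ρ w) / N w < ε := by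
          intro w hw
          refine ⟨div_nonneg (ordinalParity_nonneg _) (hN0 w).le, ?_⟩
          rcases eq_or_ne (ρ w) 0 with h0 | h0
          · simpa [h0]
          · have hNw : 1 / ε < N w := by
              by_contra! hc
              exact hw ⟨h0, hc⟩
            rw [div_lt_iff₀ (hN0 w)]
            rw [div_lt_iff₀ hε] at hNw
            linarith [ordinalParity_le_one (ρ w)]
        refine ⟨_, hsmall, fun y hy z hz _ _ => ?_⟩
        have h1 := key y hy
        have h2 := key z hz
        rw [abs_sub_lt_iff]
        constructor <;> linarith
  · refine oscIndex_le fun ε hε => oscIndexAt_le_of_rank (omega0_opow_lt_omega_one hη)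
      -- The `+ 1` separates the support from its complement, so the jump of this factor to `0` is
      -- not seen. It costs nothing, as `ω ^ η` is a limit.
      (fun x => if ρ x = 0 then 0 else ρ x / ω ^ ξ + 1) (fun x => ?_) fun x => ?_
    · split_ifs
      · exact opow_pos _ omega0_pos
      · exact hql.add_one_lt (hdiv x)
    · by_cases h0 : ρ x = 0
      · refine ⟨_, h.eventually_le x, fun y hy z hz _ _ => ?_⟩
        have hz0 : ∀ w, ρ w ≤ ρ x → ρ w = 0 := fun w hw => by simpa [h0] using hw
        simpa [hz0 y hy, hz0 z hz]
      · obtain ⟨M, hM, hNM⟩ := hNc x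
        refine ⟨_, (h.eventually_le x).and (Metric.continuousAt_iff'.1 hM (ε / 2) (half_pos hε)),
          ?_⟩
        have key : ∀ w, ρ w ≤ ρ x →
            ρ x / ω ^ ξ + 1 ≤ (if ρ w = 0 then 0 else ρ w / ω ^ ξ + 1) →
            (if ρ w = 0 then 0 else N w) = M w := by
          intro w hw hle
          split_ifs at hle with hc
          · simp at hle
          · rw [if_neg hc]
            exact hNM w (le_antisymm (div_le_left hw _) (by simpa using hle))
        rintro y ⟨hy, hyM⟩ z ⟨hz, hzM⟩ hxy hxz
        simp only [if_neg h0] at hxy hxz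
        rw [key y hy hxy, key z hz hxz]
        rw [← Real.dist_eq]
        calc dist (M y) (M z) ≤ dist (M y) (M x) + dist (M z) (M x) := dist_triangle_right _ _ _
          _ < ε / 2 + ε / 2 := add_lt_add hyM hzM
          _ = ε := add_halves ε
  · funext x
    rcases eq_or_ne (ρ x) 0 with h0 | h0
    · simp [h0]
    · simp [h0, (hN0 x).ne']

theorem isBaireOne_const (c : ℝ) : IsBaireOne (fun _ : K => c) :=
  ⟨fun _ _ => c, fun _ => continuous_const, fun _ => tendsto_const_nhds⟩

theorem one_mem_smallBaireClass_zero : (1 : K → ℝ) ∈ smallBaireClass K 0 := by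
  refine ⟨isBaireOne_const 1, oscIndex_le fun ε hε => ?_⟩
  refine oscIndexAt_le_of_rank (omega0_opow_lt_omega_one (omega_pos 1)) (fun _ => 0)
    (fun _ => by simp) fun x => ⟨Set.univ, univ_mem, fun y _ z _ _ _ => by simpa⟩

theorem exists_mul_oscDeriv_nonempty {ξ η γ : Ordinal.{u}} (hξ : ξ < ω_ 1) (hη : η < ω_ 1)
    (hK : (CantorBendixson.iteratedDerivedSet (Set.univ : Set K) (ω ^ (ξ + η))).Nonempty)
    (hγ : γ < ω ^ (ξ + η)) :
    ∃ f ∈ smallBaireClass K ξ, ∃ g ∈ smallBaireClass K η, (oscDeriv (f * g) 1 γ).Nonempty := by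
  obtain ⟨p, hp⟩ := hK
  have hξη : (ω : Ordinal.{u}) ^ (ξ + η) < ω_ 1 :=
    omega0_opow_lt_omega_one (isPrincipal_add_omega 1 hξ hη)
  obtain ⟨ρ, hρ, hρp, hρle, -⟩ := exists_isScatteredRank γ (hγ.trans hξη) p
    (CantorBendixson.iteratedDerivedSet_antitone _ hγ.le hp) Set.univ univ_mem
  have hmem : p ∈ oscDeriv (fun x => ordinalParity (ρ x)) 1 γ :=
    hρ.le_oscDeriv_parity γ hρp.ge
  have hlt : ξ + η ≠ 0 → ∀ x, ρ x < ω ^ (ξ + η) := fun h0 x =>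
    (hρle x).trans_lt (isPrincipal_add_omega0_opow _
      ((one_lt_omega0).trans_le (left_le_opow _ (pos_iff_ne_zero.2 h0))) hγ)
  have hpar : ξ + η ≠ 0 → (fun x => ordinalParity (ρ x)) ∈ smallBaireClass K (ξ + η) :=
    fun h0 => ⟨hρ.isBaireOne fun x hx => by simp [hx], hρ.oscIndex_parity_le hξη (hlt h0)⟩
  -- For a zero exponent `ω ^ 0 = 1` is not a limit and cannot absorb the `+ 1`; the constant `1`
  -- serves as that factor instead.
  rcases eq_or_ne ξ 0 with rfl | hξ0
  · rcases eq_or_ne η 0 with rfl | hη0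
    · have : γ = 0 := by simpa using hγ
      subst this
      exact ⟨1, one_mem_smallBaireClass_zero, 1, one_mem_smallBaireClass_zero, p,
        by simp [oscDeriv_zero]⟩
    · rw [zero_add] at hpar
      exact ⟨1, one_mem_smallBaireClass_zero, _, hpar hη0, p, by rwa [one_mul]⟩
  · rcases eq_or_ne η 0 with rfl | hη0
    · rw [add_zero] at hpar
      exact ⟨_, hpar hξ0, 1, one_mem_smallBaireClass_zero, p, by rwa [mul_one]⟩
    · obtain ⟨f, hf, g, hg, hfg⟩ :=
        hρ.exists_factorization hξ0 hη0 hξ hη (hlt (by simp [hξ0]))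
      exact ⟨f, hf, g, hg, p, by rwa [hfg]⟩

end Factorization

theorem mainTheorem6 {K : Type u} [MetricSpace K] [CompactSpace K]
    (ξ₁ ξ₂ ξ : Ordinal.{u}) (hξ₁ : ξ₁ < ω_ 1) (hξ₂ : ξ₂ < ω_ 1)
    (hξ : ξ = max (ξ₁ + ξ₂) (ξ₂ + ξ₁))
    (hK : (CantorBendixson.iteratedDerivedSet (Set.univ : Set K) (ω ^ ξ)).Nonempty) :
    IsLUB {b : Ordinal.{u} | ∃ f ∈ smallBaireClass K ξ₁, ∃ g ∈ smallBaireClass K ξ₂,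
        b = oscIndex (f * g)}
      (ω ^ ξ) := by
  constructor
  · rintro _ ⟨f, hf, g, hg, rfl⟩
    rw [hξ]
    exact oscIndex_mul_le hξ₁ hξ₂ hf.2 hg.2
  · intro c hc
    refine le_of_forall_lt fun γ hγ => ?_
    have hξω : ξ < ω_ 1 := hξ ▸
      max_lt (isPrincipal_add_omega 1 hξ₁ hξ₂) (isPrincipal_add_omega 1 hξ₂ hξ₁)
    have hγω : γ < ω_ 1 := hγ.trans (omega0_opow_lt_omega_one hξω)
    have hex : ∃ f ∈ smallBaireClass K ξ₁, ∃ g ∈ smallBaireClass K ξ₂,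
        (oscDeriv (f * g) 1 γ).Nonempty := by
      rcases max_choice (ξ₁ + ξ₂) (ξ₂ + ξ₁) with h | h
      · rw [hξ, h] at hK hγ
        exact exists_mul_oscDeriv_nonempty hξ₁ hξ₂ hK hγ
      · rw [hξ, h] at hK hγ
        obtain ⟨f, hf, g, hg, hfg⟩ := exists_mul_oscDeriv_nonempty hξ₂ hξ₁ hK hγ
        exact ⟨g, hg, f, hf, mul_comm f g ▸ hfg⟩
    obtain ⟨f, hf, g, hg, hfg⟩ := hex
    exact ((lt_oscIndexAt hγω hfg).trans_le (oscIndexAt_le_oscIndex _ one_pos)).trans_le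
      (hc ⟨f, hf, g, hg, rfl⟩)
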